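/- Let $0<\alpha<1$ be irrational with continued fraction expansion $[0,a_1,a_2,\ldots]$ and convergents $p_i/q_i=[0,a_1,\ldots,a_i]$ in lowest terms ($i\ge 0$). Let $\mathbf{x}_\alpha=x_1x_2x_3\cdots$, $x_i=\lfloor (i+1)\alpha\rfloor-\lfloor i\alpha\rfloor$, be the characteristic Sturmian word of slope $\alpha$, and for $n\ge 1$ let $Y_n=x_1\cdots x_n$. A period of $Y_n$ is an integer $p$ with $1\le p\le n$ and $x_i=x_{i+p}$ for $1\le i\le n-p$ (so the trivial period $n$ is included). A lazy Ostrowski representation of $n$ is an expression $n=\sum_{0\le i\le t} d_iq_i$ with integers $t\ge 0$ and $d_0,\dots,d_t\ge 0$ such that $d_t>0$; $d_0<a_1$; $d_i\le a_{i+1}$ for $1\le i\le t$; for $2\le i\le t$, if $d_i=0$ then $d_{i-1}=a_i$; and, if $t\ge 1$ and $d_1=0$, then $d_0=a_1-1$. Then every integer $n\ge 1$ has exactly one lazy Ostrowski representation, and if it is $n=\sum_{0\le i\le t}d_iq_i$, then: (a) the number of periods of $Y_n$ (including the trivial period $n$) is equal to $\sum_{0\le i\le t} d_i$; (b) the set of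 all periods of $Y_n$ is $$\Bigl\{\, e\,q_j+\sum_{j<i\le t} d_iq_i \;:\; 1\le e\le d_j \text{ and } 0\le j\le t \Bigr\}.$$ -/

import Mathlib

/-- The partial quotient `a_i` of the continued fraction expansion `[a_0, a_1, a_2, …]` of `α`
(for `0 < α < 1` irrational, `a_0 = 0` and `a_i ≥ 1` for all `i ≥ 1`). -/
noncomputable def partialQuotient (α : ℝ) (i : ℕ) : ℕ :=
  ((GenContFract.IntFractPair.stream α i).map fun p => p.b.toNat).getD 0

/-- The denominator `q_i` of the `i`-th convergent `p_i / q_i = [a_0, a_1, …, a_i]` of `α`. -/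
noncomputable def convergentDen (α : ℝ) (i : ℕ) : ℕ :=
  (Real.convergent α i).den

/-- The `i`-th letter (`i ≥ 1`) of the characteristic Sturmian word of slope `α`. -/
noncomputable def sturmianLetter (α : ℝ) (i : ℕ) : ℤ :=
  ⌊((i : ℝ) + 1) * α⌋ - ⌊(i : ℝ) * α⌋

/-- The prefix `x_1 x_2 ⋯ x_n` of length `n` of the characteristic Sturmian word of slope `α`. -/
noncomputable def sturmianPrefix (α : ℝ) (n : ℕ) : List ℤ :=
  (List.range n).map fun k => sturmianLetter α (k + 1)

/-- The set of all periods `p`, `1 ≤ p ≤ |w|`, of a finite word `w`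
(including the trivial period `|w|`). -/
def periods {A : Type*} (w : List A) : Set ℕ :=
  {p | 1 ≤ p ∧ p ≤ w.length ∧ w.HasPeriod p}

/-- `d_t d_{t-1} ⋯ d_0` is a lazy Ostrowski representation of `n` in the numeration system
attached to `α`. The digits are given by a function `d : ℕ → ℕ` that is `0` beyond `t`. -/
structure IsLazyOstrowski (α : ℝ) (n t : ℕ) (d : ℕ → ℕ) : Prop where
  leading_pos : 0 < d t
  eq_zero_of_lt : ∀ i, t < i → d i = 0
  digit_zero_lt : d 0 < partialQuotient α 1
  digit_le : ∀ i, 1 ≤ i → i ≤ t → d i ≤ partialQuotient α (i + 1)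
  lazy : ∀ i, 2 ≤ i → i ≤ t → d i = 0 → d (i - 1) = partialQuotient α i
  lazy_one : 1 ≤ t → d 1 = 0 → d 0 + 1 = partialQuotient α 1
  sum_eq : n = ∑ i ∈ Finset.range (t + 1), d i * convergentDen α i

/-- The set `{ e q_j + ∑_{j < i ≤ t} d_i q_i : 1 ≤ e ≤ d_j, 0 ≤ j ≤ t }`. -/
def ostrowskiPartialSums (α : ℝ) (t : ℕ) (d : ℕ → ℕ) : Set ℕ :=
  {p | ∃ j e : ℕ, j ≤ t ∧ 1 ≤ e ∧ e ≤ d j ∧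
    p = e * convergentDen α j + ∑ i ∈ Finset.Ioc j t, d i * convergentDen α i}

/-! Write `p_t/q_t` for the convergents. Since `q_t α - p_t` is a best approximation error,
translating `i` by `q_t` shifts `⌊iα⌋` by exactly `p_t` for `0 < i < q_{t+1}`, and this fails at `i
= q_{t+1}`. Hence `q_t` is the smallest period of `Y_n` when `q_t + q_{t-1} ≤ n + 1 < q_{t+1} + q_t`
(`contDen_mem_periods`, `contDen_le_of_mem_periods`; for `t = 0` the lower bound is void). Removing
the smallest period `q` leaves a prefix whose periods, increased by `q`, are all the others
(`periods_eq_insert_image`).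

On the arithmetic side, the digits below position `t + 1` of a lazy expansion have a value between
`q_t - 1` and `q_{t+1} + q_t - 2`. This makes every digit a determined quotient, which gives
existence and uniqueness. The same bounds say that `q_t` is the smallest period at each of the `d_t`
successive removals of `q_t`, so peeling periods reads off the digits from the top. -/

open GenContFract

/-! ### Gauss map and continuants -/

/-- The fractional parts of the complete quotients of `α ∈ (0, 1)`. -/
noncomputable def gaussIter (α : ℝ) : ℕ → ℝ
  | 0 => α
  | n + 1 => Int.fract (gaussIter α n)⁻¹

/-- The numerators of the convergents of `α ∈ (0, 1)`, defined by their recurrence. -/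
noncomputable def contNum (α : ℝ) : ℕ → ℕ
  | 0 => 0
  | 1 => 1
  | n + 2 => partialQuotient α (n + 2) * contNum α (n + 1) + contNum α n

/-- The denominators of the convergents of `α ∈ (0, 1)`, defined by their recurrence. -/
noncomputable def contDen (α : ℝ) : ℕ → ℕ
  | 0 => 1
  | 1 => partialQuotient α 1
  | n + 2 => partialQuotient α (n + 2) * contDen α (n + 1) + contDen α n

theorem gaussIter_irrational {α : ℝ} (hα : Irrational α) (n : ℕ) :
    Irrational (gaussIter α n) := by
  induction n with
  | zero => exact hα
  | succ n ih =>
    exact ih.inv.sub_intCast ⌊(gaussIter α n)⁻¹⌋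

theorem gaussIter_pos {α : ℝ} (hα : Irrational α) (hα0 : 0 < α) (n : ℕ) :
    0 < gaussIter α n := by
  cases n with
  | zero => exact hα0
  | succ n =>
    exact lt_of_le_of_ne (Int.fract_nonneg _) (gaussIter_irrational hα (n + 1)).ne_zero.symm

theorem gaussIter_lt_one {α : ℝ} (hα1 : α < 1) (n : ℕ) : gaussIter α n < 1 := by
  cases n with
  | zero => exact hα1
  | succ n => exact Int.fract_lt_one _

theorem stream_fr {α : ℝ} (hα : Irrational α) (hα0 : 0 < α) (hα1 : α < 1) (n : ℕ) :
    ∃ p, IntFractPair.stream α n = some p ∧ p.fr = gaussIter α n := by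
  induction n with
  | zero => exact ⟨_, rfl, Int.fract_eq_self.2 ⟨hα0.le, hα1⟩⟩
  | succ n ih =>
    obtain ⟨p, hp, hf⟩ := ih
    refine ⟨_, IntFractPair.stream_succ_of_some hp ?_, ?_⟩
    · rw [hf]; exact (gaussIter_pos hα hα0 n).ne'
    · rw [hf]; rfl

theorem stream_succ_eq {α : ℝ} (hα : Irrational α) (hα0 : 0 < α) (hα1 : α < 1) (n : ℕ) :
    IntFractPair.stream α (n + 1) = some (IntFractPair.of (gaussIter α n)⁻¹) := by
  obtain ⟨p, hp, hf⟩ := stream_fr hα hα0 hα1 n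
  rw [← hf]
  exact IntFractPair.stream_succ_of_some hp (hf ▸ (gaussIter_pos hα hα0 n).ne')

theorem partialQuotient_succ {α : ℝ} (hα : Irrational α) (hα0 : 0 < α) (hα1 : α < 1) (n : ℕ) :
    (partialQuotient α (n + 1) : ℤ) = ⌊(gaussIter α n)⁻¹⌋ := by
  rw [partialQuotient, stream_succ_eq hα hα0 hα1]
  have := gaussIter_pos hα hα0 n
  simp [IntFractPair.of, Int.floor_nonneg, this.le]

theorem partialQuotient_pos {α : ℝ} (hα : Irrational α) (hα0 : 0 < α) (hα1 : α < 1) (n : ℕ) :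
    1 ≤ partialQuotient α (n + 1) := by
  have h : (1 : ℤ) ≤ partialQuotient α (n + 1) := by
    rw [partialQuotient_succ hα hα0 hα1, Int.le_floor, Int.cast_one]
    exact (one_le_inv₀ (gaussIter_pos hα hα0 n)).2 (gaussIter_lt_one hα1 n).le
  exact_mod_cast h

theorem partialQuotient_add_gaussIter {α : ℝ} (hα : Irrational α) (hα0 : 0 < α) (hα1 : α < 1)
    (n : ℕ) : (partialQuotient α (n + 1) : ℝ) + gaussIter α (n + 1) = (gaussIter α n)⁻¹ := by
  have h := partialQuotient_succ hα hα0 hα1 n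
  have : (partialQuotient α (n + 1) : ℝ) = (⌊(gaussIter α n)⁻¹⌋ : ℝ) := by exact_mod_cast h
  rw [this]
  exact Int.floor_add_fract _

theorem of_get? {α : ℝ} (hα : Irrational α) (hα0 : 0 < α) (hα1 : α < 1) (n : ℕ) :
    (GenContFract.of α).s.get? n = some ⟨1, (partialQuotient α (n + 1) : ℝ)⟩ := by
  rw [get?_of_eq_some_of_succ_get?_intFractPair_stream (stream_succ_eq hα hα0 hα1 n)]
  have h := partialQuotient_succ hα hα0 hα1 n
  have : (partialQuotient α (n + 1) : ℝ) = (⌊(gaussIter α n)⁻¹⌋ : ℝ) := by exact_mod_cast h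
  rw [this]; rfl

theorem of_nums_dens {α : ℝ} (hα : Irrational α) (hα0 : 0 < α) (hα1 : α < 1) (n : ℕ) :
    (GenContFract.of α).nums n = contNum α n ∧ (GenContFract.of α).dens n = contDen α n := by
  have hfl : ⌊α⌋ = 0 := Int.floor_eq_zero_iff.2 ⟨hα0.le, hα1⟩
  induction n using Nat.twoStepInduction with
  | zero => simp [contNum, contDen, hfl]
  | one =>
    rw [first_num_eq (of_get? hα hα0 hα1 0), first_den_eq (of_get? hα hα0 hα1 0)]
    simp [contNum, contDen, hfl]
  | more n h1 h2 =>
    rw [nums_recurrence (of_get? hα hα0 hα1 (n + 1)) h1.1 h2.1,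
      dens_recurrence (of_get? hα hα0 hα1 (n + 1)) h1.2 h2.2]
    simp [contNum, contDen]

theorem contDet {α : ℝ} (n : ℕ) :
    (contNum α n : ℤ) * contDen α (n + 1) - contDen α n * contNum α (n + 1) = (-1) ^ (n + 1) := by
  induction n with
  | zero => simp [contNum, contDen]
  | succ n ih =>
    rw [pow_succ, ← ih]
    simp only [contNum, contDen]
    push_cast
    ring

theorem contNum_coprime_contDen {α : ℝ} (n : ℕ) : (contNum α n).Coprime (contDen α n) := by
  rw [← Nat.isCoprime_iff_coprime]
  have h := contDet (α := α) n
  refine ⟨(-1) ^ (n + 1) * contDen α (n + 1), -(-1) ^ (n + 1) * contNum α (n + 1), ?_⟩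
  calc _ = (-1 : ℤ) ^ (n + 1) * (contNum α n * contDen α (n + 1) -
          contDen α n * contNum α (n + 1)) := by ring
    _ = 1 := by rw [h, ← mul_pow]; simp

theorem contDen_pos {α : ℝ} (hα : Irrational α) (hα0 : 0 < α) (hα1 : α < 1) (n : ℕ) :
    0 < contDen α n := by
  induction n using Nat.twoStepInduction with
  | zero => simp [contDen]
  | one => exact partialQuotient_pos hα hα0 hα1 0
  | more n h1 h2 => rw [contDen]; omega

theorem convergentDen_eq_contDen {α : ℝ} (hα : Irrational α) (hα0 : 0 < α) (hα1 : α < 1) (n : ℕ) :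
    convergentDen α n = contDen α n := by
  have h := Real.convs_eq_convergent α n
  obtain ⟨hn, hd⟩ := of_nums_dens hα hα0 hα1 n
  rw [conv_eq_num_div_den, hn, hd] at h
  have h' : Real.convergent α n = ((contNum α n : ℤ) : ℚ) / ((contDen α n : ℤ) : ℚ) := by
    have : (((contNum α n : ℚ) / contDen α n : ℚ) : ℝ) = Real.convergent α n := by
      push_cast; exact h
    push_cast
    exact_mod_cast this.symm
  have := Rat.den_div_eq_of_coprime (a := contNum α n) (b := contDen α n)
    (by exact_mod_cast contDen_pos hα hα0 hα1 n) (by simpa using contNum_coprime_contDen n)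
  rw [← h'] at this
  exact_mod_cast this

/-! ### Approximation errors and shifted floors -/

/-- The signed error `q_n α - p_n` of the `n`-th convergent. -/
noncomputable def convergentErr (α : ℝ) (n : ℕ) : ℝ := contDen α n * α - contNum α n

/-- The relation between consecutive complete quotients turns the two-term recurrence into a
product, so errors alternate in sign and shrink. -/
theorem convergentErr_succ {α : ℝ} (hα : Irrational α) (hα0 : 0 < α) (hα1 : α < 1) (n : ℕ) :
    convergentErr α (n + 1) = -(convergentErr α n * gaussIter α (n + 1)) := by
  induction n with
  | zero =>
    have h := partialQuotient_add_gaussIter hα hα0 hα1 0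
    simp only [convergentErr, contDen, contNum, gaussIter] at h ⊢
    have h' : (partialQuotient α 1 : ℝ) = α⁻¹ - Int.fract α⁻¹ := by rw [← h]; simp
    simp only [zero_add] at *
    rw [h']
    field_simp
    push_cast
    ring
  | succ n ih =>
    have h := partialQuotient_add_gaussIter hα hα0 hα1 (n + 1)
    have hg := (gaussIter_pos hα hα0 (n + 1)).ne'
    have hrec : convergentErr α (n + 2) =
        partialQuotient α (n + 2) * convergentErr α (n + 1) + convergentErr α n := by
      simp only [convergentErr, contDen, contNum]; push_cast; ring
    have h' : convergentErr α n = -(convergentErr α (n + 1) * (gaussIter α (n + 1))⁻¹) := by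
      rw [ih]; field_simp
    rw [hrec, h', ← h]; ring

theorem convergentErr_sign {α : ℝ} (hα : Irrational α) (hα0 : 0 < α) (hα1 : α < 1) (n : ℕ) :
    (0 < convergentErr α n ∧ convergentErr α (n + 1) < 0 ∧
      0 < convergentErr α n + convergentErr α (n + 1)) ∨
    (convergentErr α n < 0 ∧ 0 < convergentErr α (n + 1) ∧
      convergentErr α n + convergentErr α (n + 1) < 0) := by
  have key (m : ℕ) : convergentErr α m + convergentErr α (m + 1) =
      convergentErr α m * (1 - gaussIter α (m + 1)) := by
    rw [convergentErr_succ hα hα0 hα1]; ring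
  have hg (m : ℕ) := gaussIter_pos hα hα0 m
  have hg1 (m : ℕ) : 0 < 1 - gaussIter α m := sub_pos.2 (gaussIter_lt_one hα1 m)
  have step (m : ℕ) : (0 < convergentErr α m → convergentErr α (m + 1) < 0) ∧
      (convergentErr α m < 0 → 0 < convergentErr α (m + 1)) := by
    rw [convergentErr_succ hα hα0 hα1]
    exact ⟨fun h => neg_lt_zero.2 (mul_pos h (hg _)),
      fun h => neg_pos.2 (mul_neg_of_neg_of_pos h (hg _))⟩
  have sgn : 0 < convergentErr α n ∨ convergentErr α n < 0 := by
    induction n with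
    | zero => left; simpa [convergentErr, contDen, contNum] using hα0
    | succ n ih => exact ih.elim (fun h => .inr ((step n).1 h)) (fun h => .inl ((step n).2 h))
  rw [key]
  exact sgn.imp (fun h => ⟨h, (step n).1 h, mul_pos h (hg1 _)⟩)
    (fun h => ⟨h, (step n).2 h, mul_neg_of_neg_of_pos h (hg1 _)⟩)

/-- In the lattice basis of two consecutive convergents, `0 < i < q_{t+1}` forces coordinates of
opposite (weak) signs with `|x| ≥ 1`. The errors also have opposite signs, so the two terms
reinforce each other. -/
theorem abs_convergentErr_le {α : ℝ} (hα : Irrational α) (hα0 : 0 < α) (hα1 : α < 1) (t : ℕ)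
    {i : ℤ} (hi0 : 0 < i) (hi : i < contDen α (t + 1)) (m : ℤ) :
    |convergentErr α t| ≤ |i * α - m| := by
  have hdet := contDet (α := α) t
  have hq : (0 : ℤ) < contDen α t := by exact_mod_cast contDen_pos hα hα0 hα1 t
  have hq' : (0 : ℤ) < contDen α (t + 1) := by exact_mod_cast contDen_pos hα hα0 hα1 (t + 1)
  have hε : ((-1 : ℤ) ^ (t + 1)) * (-1) ^ (t + 1) = 1 := by rw [← mul_pow]; simp
  obtain ⟨x, y, hx, hy⟩ : ∃ x y : ℤ, i = x * contDen α t + y * contDen α (t + 1) ∧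
      m = x * contNum α t + y * contNum α (t + 1) := by
    -- Cramer's rule; the determinant is `±1` by `contDet`.
    refine ⟨-(-1) ^ (t + 1) * (i * contNum α (t + 1) - m * contDen α (t + 1)),
      (-1) ^ (t + 1) * (i * contNum α t - m * contDen α t), ?_, ?_⟩
    · linear_combination (-i) * hε - (-1) ^ (t + 1) * i * hdet
    · linear_combination (-m) * hε - (-1) ^ (t + 1) * m * hdet
  have hval : (i : ℝ) * α - m = x * convergentErr α t + y * convergentErr α (t + 1) := by
    rw [hx, hy]; simp only [convergentErr]; push_cast; ring
  rw [hval]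
  have hxy : (1 ≤ x ∧ y ≤ 0) ∨ (x ≤ -1 ∧ 0 ≤ y) := by
    rcases lt_trichotomy x 0 with h | h | h
    · right
      refine ⟨by omega, ?_⟩
      by_contra! hy0
      nlinarith
    · subst h
      rcases le_or_gt y 0 with h | h <;> nlinarith
    · left
      refine ⟨by omega, ?_⟩
      by_contra! hy0
      nlinarith
  have hxy' : ((1 : ℝ) ≤ x ∧ (y : ℝ) ≤ 0) ∨ ((x : ℝ) ≤ -1 ∧ (0 : ℝ) ≤ y) := by
    exact_mod_cast hxy
  rcases convergentErr_sign hα hα0 hα1 t with ⟨h1, h2, -⟩ | ⟨h1, h2, -⟩ <;>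
  rcases hxy' with ⟨h3, h4⟩ | ⟨h3, h4⟩
  · rw [abs_of_pos h1]
    exact le_trans (by nlinarith) (le_abs_self _)
  · rw [abs_of_pos h1]
    exact le_trans (by nlinarith) (neg_le_abs _)
  · rw [abs_of_neg h1]
    exact le_trans (by nlinarith) (neg_le_abs _)
  · rw [abs_of_neg h1]
    exact le_trans (by nlinarith) (le_abs_self _)

/-- Modulo `p_t`, the shift is by an error no larger than the distance from `iα` to any integer, so
none is crossed; irrationality excludes landing on the upper one. -/
theorem floor_add_contDen {α : ℝ} (hα : Irrational α) (hα0 : 0 < α) (hα1 : α < 1) (t : ℕ)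
    {i : ℕ} (hi0 : 0 < i) (hi : i < contDen α (t + 1)) :
    ⌊((i + contDen α t : ℕ) : ℝ) * α⌋ = ⌊(i : ℝ) * α⌋ + contNum α t := by
  have best (m : ℤ) : |convergentErr α t| ≤ |(i : ℝ) * α - m| := by
    exact_mod_cast abs_convergentErr_le hα hα0 hα1 t (by exact_mod_cast hi0)
      (by exact_mod_cast hi) m
  have hval : ((i + contDen α t : ℕ) : ℝ) * α =
      i * α + convergentErr α t + (contNum α t : ℤ) := by
    simp only [convergentErr]; push_cast; ring
  have hne (m : ℤ) : (i : ℝ) * α + convergentErr α t ≠ m := by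
    have h := (hα.natCast_mul (m := i + contDen α t) (by omega)).ne_int (m + contNum α t)
    intro h'
    rw [hval, h'] at h
    push_cast at h
    exact h rfl
  rw [hval, Int.floor_add_intCast]
  congr 1
  rw [Int.floor_eq_iff]
  have hl := Int.floor_le ((i : ℝ) * α)
  have hr := Int.lt_floor_add_one ((i : ℝ) * α)
  have hbl := best ⌊(i : ℝ) * α⌋
  have hbr := best (⌊(i : ℝ) * α⌋ + 1)
  have hnr := hne (⌊(i : ℝ) * α⌋ + 1)
  push_cast at hbr hnr
  rw [abs_of_nonneg (a := (i : ℝ) * α - _) (by linarith)] at hbl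
  rw [abs_of_nonpos (a := (i : ℝ) * α - _) (by linarith)] at hbr
  obtain ⟨h1, h2⟩ := abs_le.1 (le_refl |convergentErr α t|)
  exact ⟨by linarith, lt_of_le_of_ne (by linarith) hnr⟩

/-- The errors before and after the shift have opposite signs, so the integer `p_{t+1}` is crossed.
-/
theorem floor_contDen_add_ne {α : ℝ} (hα : Irrational α) (hα0 : 0 < α) (hα1 : α < 1) (t : ℕ) :
    ⌊((contDen α (t + 1) + contDen α t : ℕ) : ℝ) * α⌋ ≠
      ⌊(contDen α (t + 1) : ℝ) * α⌋ + contNum α t := by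
  have h1 : (contDen α (t + 1) : ℝ) * α = convergentErr α (t + 1) + (contNum α (t + 1) : ℤ) := by
    simp only [convergentErr]; push_cast; ring
  have h2 : ((contDen α (t + 1) + contDen α t : ℕ) : ℝ) * α =
      convergentErr α t + convergentErr α (t + 1) + (contNum α (t + 1) + contNum α t : ℤ) := by
    simp only [convergentErr]; push_cast; ring
  rw [h1, h2, Int.floor_add_intCast, Int.floor_add_intCast]
  intro h
  have h' : ⌊convergentErr α t + convergentErr α (t + 1)⌋ = ⌊convergentErr α (t + 1)⌋ := by
    omega
  rcases convergentErr_sign hα hα0 hα1 t with ⟨_, h3, h4⟩ | ⟨_, h3, h4⟩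
  · have := Int.floor_lt_zero.2 h3
    have := Int.floor_nonneg.2 h4.le
    omega
  · have := Int.floor_lt_zero.2 h4
    have := Int.floor_nonneg.2 h3.le
    omega

/-! ### Periods of Sturmian prefixes -/

theorem mem_periods_sturmianPrefix {α : ℝ} {n p : ℕ} :
    p ∈ periods (sturmianPrefix α n) ↔
      1 ≤ p ∧ p ≤ n ∧ ∀ i, i + p < n → sturmianLetter α (i + 1) = sturmianLetter α (i + p + 1) := by
  simp only [periods, Set.mem_ofPred_eq, List.hasPeriod_iff_getElem?]
  have hlen : (sturmianPrefix α n).length = n := by simp [sturmianPrefix]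
  rw [hlen]
  refine and_congr_right fun _ => and_congr_right fun _ => forall_congr' fun i => ?_
  constructor
  · intro h hi
    have := h (by omega)
    simpa [sturmianPrefix, hi, show i < n by omega] using this
  · intro h hi
    simpa [sturmianPrefix, show i + p < n by omega, show i < n by omega] using h (by omega)

/-- Letters are first differences of floors, so periodicity means a constant increment; the bound is
`n + 1` because `x_n` involves `⌊(n+1)α⌋`. -/
theorem mem_periods_iff_floor {α : ℝ} {n p : ℕ} :
    p ∈ periods (sturmianPrefix α n) ↔ 1 ≤ p ∧ p ≤ n ∧ ∃ m : ℤ, ∀ i, 1 ≤ i → i + p ≤ n + 1 →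
      ⌊((i + p : ℕ) : ℝ) * α⌋ = ⌊(i : ℝ) * α⌋ + m := by
  rw [mem_periods_sturmianPrefix]
  refine and_congr_right fun _ => and_congr_right fun hpn => ?_
  have hlet (k : ℕ) : sturmianLetter α k = ⌊((k + 1 : ℕ) : ℝ) * α⌋ - ⌊(k : ℝ) * α⌋ := by
    simp [sturmianLetter]
  constructor
  · intro h
    refine ⟨⌊((1 + p : ℕ) : ℝ) * α⌋ - ⌊((1 : ℕ) : ℝ) * α⌋, fun i hi => ?_⟩
    induction i, hi using Nat.le_induction with
    | base => intro _; ring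
    | succ i hi ih =>
      intro hn
      have h1 := ih (by omega)
      have h2 := h (i - 1) (by omega)
      rw [show i - 1 + 1 = i by omega, show i - 1 + p + 1 = i + p by omega, hlet, hlet] at h2
      rw [show i + 1 + p = i + p + 1 by omega]
      linarith
  · rintro ⟨m, hm⟩ i hi
    have h1 := hm (i + 1) (by omega) (by omega)
    have h2 := hm (i + 2) (by omega) (by omega)
    rw [hlet, hlet, show i + p + 1 + 1 = i + 2 + p by omega, h2,
      show i + p + 1 = i + 1 + p by omega, h1]
    ring

theorem contDen_mem_periods {α : ℝ} (hα : Irrational α) (hα0 : 0 < α) (hα1 : α < 1) {n t : ℕ}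
    (hn : contDen α t ≤ n) (hn' : n + 2 ≤ contDen α (t + 1) + contDen α t) :
    contDen α t ∈ periods (sturmianPrefix α n) :=
  mem_periods_iff_floor.2 ⟨contDen_pos hα hα0 hα1 t, hn, contNum α t, fun _ hi hin =>
    floor_add_contDen hα hα0 hα1 t hi (by omega)⟩

theorem contDen_le_of_mem_periods {α : ℝ} (hα : Irrational α) (hα0 : 0 < α) (hα1 : α < 1)
    {n t p : ℕ} (hn : t ≠ 0 → contDen α t + contDen α (t - 1) ≤ n + 1)
    (hp : p ∈ periods (sturmianPrefix α n)) : contDen α t ≤ p := by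
  obtain ⟨hp1, hpn, m, hm⟩ := mem_periods_iff_floor.1 hp
  cases t with
  | zero => exact hp1
  | succ t =>
    by_contra! hlt
    have hn := hn (by omega)
    simp only [Nat.add_sub_cancel] at hn
    have hpos := contDen_pos hα hα0 hα1 t
    -- A shorter period `p` would carry the regular shift by `q_t` at `q_{t+1} - p` to the irregular
    -- one at `q_{t+1}`.
    have h1 := hm (contDen α (t + 1) - p) (by omega) (by omega)
    have h2 := hm (contDen α (t + 1) - p + contDen α t) (by omega) (by omega)
    have h3 := floor_add_contDen hα hα0 hα1 t (i := contDen α (t + 1) - p) (by omega) (by omega)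
    rw [show contDen α (t + 1) - p + p = contDen α (t + 1) by omega] at h1
    rw [show contDen α (t + 1) - p + contDen α t + p = contDen α (t + 1) + contDen α t by omega]
      at h2
    apply floor_contDen_add_ne hα hα0 hα1 t
    linarith

/-- Removing the smallest period `q` from a prefix removes `q` from all its other periods. -/
theorem periods_eq_insert_image {α : ℝ} {n q : ℕ} (hq : q ∈ periods (sturmianPrefix α n))
    (hmin : ∀ p ∈ periods (sturmianPrefix α n), q ≤ p) :
    periods (sturmianPrefix α n) =
      insert q ((fun p => q + p) '' periods (sturmianPrefix α (n - q))) := by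
  have hq' := mem_periods_sturmianPrefix.1 hq
  ext p
  simp only [Set.mem_insert_iff, Set.mem_image]
  constructor
  · intro hp
    rcases (hmin p hp).eq_or_lt with h | h
    · exact .inl h.symm
    · obtain ⟨h1, h2, h3⟩ := mem_periods_sturmianPrefix.1 hp
      refine .inr ⟨p - q, mem_periods_sturmianPrefix.2 ⟨by omega, by omega, fun i hi => ?_⟩,
        by omega⟩
      rw [h3 i (by omega), hq'.2.2 (i + (p - q)) (by omega)]
      congr 1; omega
  · rintro (rfl | ⟨r, hr, rfl⟩)
    · exact hq
    · obtain ⟨h1, h2, h3⟩ := mem_periods_sturmianPrefix.1 hr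
      refine mem_periods_sturmianPrefix.2 ⟨by omega, by omega, fun i hi => ?_⟩
      rw [h3 i (by omega), hq'.2.2 (i + r) (by omega)]
      congr 1; omega
-- Lazy expansions in a continuant numeration system
open Finset

/-- `q` is the sequence of continuant denominators of the partial quotients `a 1, a 2, …`. -/
structure IsContinuantSeq (a q : ℕ → ℕ) : Prop where
  one_le : ∀ n, 1 ≤ a (n + 1)
  zero : q 0 = 1
  one : q 1 = a 1
  recurrence : ∀ n, q (n + 2) = a (n + 2) * q (n + 1) + q n

/-- The digits `d i`, `i < t`, satisfy the conditions of a lazy Ostrowski representation, except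
possibly the positivity of the leading digit. -/
structure LazyBelow (a d : ℕ → ℕ) (t : ℕ) : Prop where
  zero_lt : d 0 < a 1
  le : ∀ i, 1 ≤ i → i < t → d i ≤ a (i + 1)
  lazy : ∀ i, 2 ≤ i → i < t → d i = 0 → d (i - 1) = a i
  lazy_one : 1 < t → d 1 = 0 → d 0 + 1 = a 1

/-- The number represented by the digits `d i`, `i < t`, in the numeration system `q`. -/
def digitValue (q d : ℕ → ℕ) (t : ℕ) : ℕ := ∑ i ∈ range t, d i * q i

theorem digitValue_succ (q d : ℕ → ℕ) (t : ℕ) :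
    digitValue q d (t + 1) = digitValue q d t + d t * q t := sum_range_succ _ _

theorem digitValue_congr {q d d' : ℕ → ℕ} {t : ℕ} (h : ∀ i < t, d i = d' i) :
    digitValue q d t = digitValue q d' t :=
  sum_congr rfl fun i hi => by rw [h i (mem_range.1 hi)]

theorem LazyBelow.mono {a d : ℕ → ℕ} {s t : ℕ} (h : LazyBelow a d t) (hst : s ≤ t) :
    LazyBelow a d s where
  zero_lt := h.zero_lt
  le i h1 h2 := h.le i h1 (by omega)
  lazy i h1 h2 := h.lazy i h1 (by omega)
  lazy_one h1 := h.lazy_one (by omega)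

theorem LazyBelow.congr {a d d' : ℕ → ℕ} {t : ℕ} (h : LazyBelow a d (t + 1))
    (hd : ∀ i < t + 1, d' i = d i) : LazyBelow a d' (t + 1) where
  zero_lt := by rw [hd 0 (by omega)]; exact h.zero_lt
  le i h1 h2 := by rw [hd i h2]; exact h.le i h1 h2
  lazy i h1 h2 := by rw [hd i h2, hd (i - 1) (by omega)]; exact h.lazy i h1 h2
  lazy_one h1 := by rw [hd 0 (by omega), hd 1 h1]; exact h.lazy_one h1

namespace IsContinuantSeq

variable {a q d : ℕ → ℕ}

theorem pos (hq : IsContinuantSeq a q) (n : ℕ) : 0 < q n := by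
  induction n using Nat.twoStepInduction with
  | zero => simp [hq.zero]
  | one => rw [hq.one]; exact hq.one_le 0
  | more n h1 h2 => rw [hq.recurrence]; omega

theorem add_le (hq : IsContinuantSeq a q) (n : ℕ) : q (n + 1) + q n ≤ q (n + 2) := by
  rw [hq.recurrence]
  have : q (n + 1) ≤ a (n + 2) * q (n + 1) := Nat.le_mul_of_pos_left _ (hq.one_le (n + 1))
  omega

theorem strictMono_add (hq : IsContinuantSeq a q) : StrictMono fun n => q (n + 1) + q n :=
  strictMono_nat_of_lt_succ fun n => by
    have := hq.add_le n
    change q (n + 1) + q n < q (n + 2) + q (n + 1)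
    have := hq.pos (n + 1)
    omega

/-- Maximal digits telescope to equality; laziness plays no role here. -/
theorem digitValue_add_two_le (hq : IsContinuantSeq a q) {t : ℕ} (h : LazyBelow a d (t + 1)) :
    digitValue q d (t + 1) + 2 ≤ q (t + 1) + q t := by
  induction t with
  | zero =>
    have := h.zero_lt
    simp only [digitValue, sum_range_one, hq.zero, zero_add, hq.one]
    omega
  | succ t ih =>
    have h1 := ih (h.mono (by omega))
    have h2 : d (t + 1) * q (t + 1) ≤ a (t + 2) * q (t + 1) :=
      Nat.mul_le_mul_right _ (h.le (t + 1) (by omega) (by omega))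
    rw [digitValue_succ, hq.recurrence]
    omega

/-- Laziness enters here: a zero top digit makes the next one maximal, and the recurrence reduces
the claim to two positions lower. -/
theorem le_digitValue_add_one (hq : IsContinuantSeq a q) {t : ℕ} (h : LazyBelow a d (t + 1)) :
    q t ≤ digitValue q d (t + 1) + 1 := by
  have big (s : ℕ) (hs : d s ≠ 0) : q s ≤ digitValue q d (s + 1) + 1 := by
    rw [digitValue_succ]
    have := Nat.mul_le_mul_right (q s) (Nat.one_le_iff_ne_zero.2 hs)
    omega
  induction t using Nat.twoStepInduction with
  | zero => simp [hq.zero]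
  | one =>
    by_cases h0 : d 1 = 0
    · have := h.lazy_one (by omega) h0
      simp only [digitValue, sum_range_succ, sum_range_zero, hq.one, hq.zero]
      omega
    · exact big 1 h0
  | more t h1 _ =>
    by_cases h0 : d (t + 2) = 0
    · have hd := h.lazy (t + 2) (by omega) (by omega) h0
      rw [show t + 2 - 1 = t + 1 by omega] at hd
      have := h1 (h.mono (by omega))
      rw [digitValue_succ, digitValue_succ, hd, hq.recurrence]
      omega
    · exact big (t + 2) h0

/-- The two bounds confine the lower part to `q (t + 1)` consecutive values starting at `q t - 1`,
so division after that shift recovers the digit. -/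
theorem digit_eq_div (hq : IsContinuantSeq a q) {t : ℕ} (h : LazyBelow a d (t + 1)) :
    d (t + 1) = (digitValue q d (t + 2) + 1 - q t) / q (t + 1) := by
  have h1 := hq.digitValue_add_two_le h
  have h2 := hq.le_digitValue_add_one h
  rw [digitValue_succ, show digitValue q d (t + 1) + d (t + 1) * q (t + 1) + 1 - q t =
    digitValue q d (t + 1) + 1 - q t + d (t + 1) * q (t + 1) by omega,
    Nat.add_mul_div_right _ _ (hq.pos _), Nat.div_eq_of_lt (by omega), zero_add]

theorem digits_unique (hq : IsContinuantSeq a q) {d' : ℕ → ℕ} {t : ℕ} (h : LazyBelow a d t)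
    (h' : LazyBelow a d' t) (heq : digitValue q d (t + 1) = digitValue q d' (t + 1)) :
    ∀ i ≤ t, d i = d' i := by
  induction t with
  | zero =>
    intro i hi
    obtain rfl : i = 0 := by omega
    simpa [digitValue, hq.zero] using heq
  | succ t ih =>
    have htop : d (t + 1) = d' (t + 1) := by rw [hq.digit_eq_div h, hq.digit_eq_div h', heq]
    intro i hi
    rcases hi.eq_or_lt with rfl | hi
    · exact htop
    · rw [digitValue_succ, digitValue_succ _ d', htop] at heq
      exact ih (h.mono (by omega)) (h'.mono (by omega)) (by omega) i (by omega)

/-- Both bounds are sharp. The top digit may vanish, as the recursion on remainders requires. -/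
theorem exists_digits (hq : IsContinuantSeq a q) {t m : ℕ} (h1 : q t ≤ m + 1)
    (h2 : m + 2 ≤ q (t + 1) + q t) : ∃ d, LazyBelow a d (t + 1) ∧ digitValue q d (t + 1) = m := by
  induction t generalizing m with
  | zero =>
    rw [zero_add, hq.one, hq.zero] at h2
    exact ⟨fun _ => m, ⟨by omega, by omega, by omega, by omega⟩, by simp [digitValue, hq.zero]⟩
  | succ t ih =>
    have hpos := hq.pos (t + 1)
    have hle : q t ≤ m + 1 := by
      cases t with
      | zero => rw [hq.zero]; omega
      | succ t =>
        have : q (t + 1) + q t ≤ q (t + 1 + 1) := hq.add_le t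
        omega
    set k := (m + 1 - q t) / q (t + 1) with hk
    have hmod := Nat.mod_add_div (m + 1 - q t) (q (t + 1))
    have hlt := Nat.mod_lt (m + 1 - q t) hpos
    rw [← hk, mul_comm] at hmod
    have hka : k ≤ a (t + 2) := by
      rw [hq.recurrence] at h2
      refine Nat.lt_succ_iff.1 (Nat.lt_of_mul_lt_mul_right (a := q (t + 1)) ?_)
      rw [Nat.succ_mul]
      omega
    have hkm : k * q (t + 1) ≤ m := by
      have := hq.pos t
      omega
    obtain ⟨d, hd, hval⟩ := ih (m := m - k * q (t + 1)) (by omega) (by omega)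
    have hne (i : ℕ) (hi : i < t + 1) : Function.update d (t + 1) k i = d i :=
      Function.update_of_ne (by omega) _ _
    have hlow := hd.congr hne
    have hvlow := (digitValue_congr (q := q) hne).trans hval
    refine ⟨Function.update d (t + 1) k, ⟨hlow.zero_lt, fun i hi hit => ?_, fun i hi hit h0 => ?_,
      fun _ h0 => ?_⟩, ?_⟩
    · rcases (Nat.lt_succ_iff.1 hit).eq_or_lt with rfl | hlt
      · simpa using hka
      · exact hlow.le i hi hlt
    · rcases (Nat.lt_succ_iff.1 hit).eq_or_lt with rfl | hlt
      -- With top digit zero, the lower bound on `m` is too large for the remaining digits unless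
      -- the next one is maximal.
      · obtain ⟨s, rfl⟩ : ∃ s, t = s + 1 := ⟨t - 1, by omega⟩
        rw [Function.update_self] at h0
        have hk0 : k * q (s + 1 + 1) = 0 := by rw [h0, zero_mul]
        rw [hk0, Nat.sub_zero] at hvlow
        refine le_antisymm (hlow.le _ (by omega) (by omega)) ?_
        have hb := hq.digitValue_add_two_le (hlow.mono (s := s + 1) (by omega))
        rw [digitValue_succ] at hvlow
        have h1' : a (s + 1 + 1) * q (s + 1) + q s ≤ m + 1 := hq.recurrence s ▸ h1
        refine Nat.lt_succ_iff.1 (Nat.lt_of_mul_lt_mul_right (a := q (s + 1)) ?_)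
        rw [Nat.succ_mul, Nat.add_sub_cancel]
        omega
      · exact hlow.lazy i hi hlt h0
    · cases t with
      | zero =>
        rw [zero_add, Function.update_self] at h0
        have hz := hlow.zero_lt
        have hk0 : k * q (0 + 1) = 0 := by rw [h0, zero_mul]
        rw [hk0, Nat.sub_zero] at hvlow
        simp only [digitValue, zero_add, sum_range_one, hq.zero, mul_one] at hvlow hz ⊢
        rw [zero_add, hq.one] at h1
        omega
      | succ t => exact hlow.lazy_one (by omega) h0
    · rw [digitValue_succ, hvlow, Function.update_self]
      omega

/-- Locates `n` in the window where `q t` is the smallest period. -/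
theorem exists_length (hq : IsContinuantSeq a q) (n : ℕ) :
    ∃ t, (t ≠ 0 → q t + q (t - 1) ≤ n + 1) ∧ n + 2 ≤ q (t + 1) + q t := by
  classical
  have hex : ∃ t, n + 2 ≤ q (t + 1) + q t := ⟨n + 2, hq.strictMono_add.le_apply⟩
  refine ⟨Nat.find hex, fun h0 => ?_, Nat.find_spec hex⟩
  have h := Nat.find_min hex (m := Nat.find hex - 1) (by omega)
  rw [Nat.sub_add_cancel (by omega)] at h
  omega

end IsContinuantSeq

/-! ### Digits as successive smallest periods -/

/-- The set of partial sums, starting from the leading digit, of the digits `d i`, `i < t`. -/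
def digitPartialSums (q d : ℕ → ℕ) (t : ℕ) : Set ℕ :=
  {p | ∃ j e : ℕ, j < t ∧ 1 ≤ e ∧ e ≤ d j ∧ p = e * q j + ∑ i ∈ Ioo j t, d i * q i}

theorem digitPartialSums_succ (q d : ℕ → ℕ) (t : ℕ) :
    digitPartialSums q d (t + 1) = {p | ∃ e, 1 ≤ e ∧ e ≤ d t ∧ p = e * q t} ∪
      (fun p => d t * q t + p) '' digitPartialSums q d t := by
  ext p
  simp only [digitPartialSums, Set.mem_union, Set.mem_ofPred_eq, Set.mem_image]
  have hsum (j : ℕ) (hj : j < t) :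
      ∑ i ∈ Ioo j (t + 1), d i * q i = ∑ i ∈ Ioo j t, d i * q i + d t * q t := by
    rw [show Ioo j (t + 1) = insert t (Ioo j t) by ext i; simp; omega, sum_insert (by simp),
      add_comm]
  constructor
  · rintro ⟨j, e, hj, he1, he2, rfl⟩
    rcases (Nat.lt_succ_iff.1 hj).eq_or_lt with rfl | hjt
    · left
      refine ⟨e, he1, he2, ?_⟩
      rw [show Ioo j (j + 1) = ∅ by ext i; simp]; simp
    · exact .inr ⟨_, ⟨j, e, hjt, he1, he2, rfl⟩, by rw [hsum j hjt]; ring⟩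
  · rintro (⟨e, he1, he2, rfl⟩ | ⟨_, ⟨j, e, hj, he1, he2, rfl⟩, rfl⟩)
    · refine ⟨t, e, by omega, he1, he2, ?_⟩
      rw [show Ioo t (t + 1) = ∅ by ext i; simp]; simp
    · exact ⟨j, e, by omega, he1, he2, by rw [hsum j hj]; ring⟩

theorem isContinuantSeq_contDen {α : ℝ} (hα : Irrational α) (hα0 : 0 < α) (hα1 : α < 1) :
    IsContinuantSeq (partialQuotient α) (contDen α) :=
  ⟨partialQuotient_pos hα hα0 hα1, rfl, rfl, fun _ => rfl⟩

theorem finite_periods {A : Type*} (w : List A) : (periods w).Finite :=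
  (Set.finite_le_nat w.length).subset fun _ hp => hp.2.1

theorem ncard_insert_add_image_periods {α : ℝ} (q n : ℕ) :
    (insert q ((fun p => q + p) '' periods (sturmianPrefix α n))).ncard =
      (periods (sturmianPrefix α n)).ncard + 1 := by
  rw [Set.ncard_insert_of_notMem _ ((finite_periods _).image _),
    Set.ncard_image_of_injective _ (add_right_injective q)]
  rintro ⟨p, hp, h⟩
  have := hp.1
  simp only at h
  omega

theorem periods_sturmianPrefix_digitValue {α : ℝ} (hα : Irrational α) (hα0 : 0 < α) (hα1 : α < 1)
    {d : ℕ → ℕ} {t : ℕ} (h : LazyBelow (partialQuotient α) d t) :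
    periods (sturmianPrefix α (digitValue (contDen α) d t)) = digitPartialSums (contDen α) d t ∧
    (periods (sturmianPrefix α (digitValue (contDen α) d t))).ncard = ∑ i ∈ range t, d i := by
  have hq := isContinuantSeq_contDen hα hα0 hα1
  induction t with
  | zero =>
    have : periods (sturmianPrefix α (digitValue (contDen α) d 0)) = ∅ := by
      ext p
      simp only [mem_periods_sturmianPrefix, digitValue, range_zero, sum_empty]
      simp; omega
    rw [this]
    simp [digitPartialSums]
  | succ t ih =>
    obtain ⟨ih1, ih2⟩ := ih (h.mono (by omega))
    set q := contDen α with hqdef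
    -- Induction on the number `c` of copies of `q t`: for `1 ≤ c ≤ d t` the length stays in the
    -- window where `q t` is the smallest period.
    have key (c : ℕ) (hc : c ≤ d t) :
        periods (sturmianPrefix α (digitValue q d t + c * q t)) =
          {p | ∃ e, 1 ≤ e ∧ e ≤ c ∧ p = e * q t} ∪
            (fun p => c * q t + p) '' digitPartialSums q d t ∧
        (periods (sturmianPrefix α (digitValue q d t + c * q t))).ncard =
          ∑ i ∈ range t, d i + c := by
      induction c with
      | zero =>
        have : {p | ∃ e, 1 ≤ e ∧ e ≤ 0 ∧ p = e * q t} = (∅ : Set ℕ) := by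
          ext p; simp
        rw [this]
        simpa using ⟨ih1, ih2⟩
      | succ c ihc =>
        obtain ⟨hc1, hc2⟩ := ihc (by omega)
        have hsub : digitValue q d t + (c + 1) * q t - q t = digitValue q d t + c * q t := by
          rw [Nat.succ_mul]; omega
        have hlow : q t ≤ digitValue q d t + (c + 1) * q t := by rw [Nat.succ_mul]; omega
        have hup : digitValue q d t + (c + 1) * q t + 2 ≤ q (t + 1) + q t := by
          have h1 := hq.digitValue_add_two_le h
          rw [digitValue_succ] at h1
          have := Nat.mul_le_mul_right (q t) hc
          omega
        have hmin : t ≠ 0 → q t + q (t - 1) ≤ digitValue q d t + (c + 1) * q t + 1 := by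
          intro ht
          obtain ⟨s, rfl⟩ := Nat.exists_eq_succ_of_ne_zero ht
          have := hq.le_digitValue_add_one (h.mono (Nat.le_succ _))
          simp only [Nat.succ_eq_add_one, Nat.add_sub_cancel, Nat.succ_mul] at *
          omega
        have hstep := periods_eq_insert_image (contDen_mem_periods hα hα0 hα1 hlow hup)
          fun p hp => contDen_le_of_mem_periods hα hα0 hα1 hmin hp
        rw [← hqdef, hsub] at hstep
        rw [hstep]
        refine ⟨?_, by rw [ncard_insert_add_image_periods, hc2, add_assoc]⟩
        rw [hc1]
        ext p
        simp only [Set.mem_insert_iff, Set.mem_image, Set.mem_union, Set.mem_ofPred_eq]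
        constructor
        · rintro (rfl | ⟨_, ⟨e, he1, he2, rfl⟩ | ⟨r, hr, rfl⟩, rfl⟩)
          · exact .inl ⟨1, le_rfl, by omega, (one_mul _).symm⟩
          · exact .inl ⟨e + 1, by omega, by omega, by ring⟩
          · exact .inr ⟨r, hr, by ring⟩
        · rintro (⟨e, he1, he2, rfl⟩ | ⟨r, hr, rfl⟩)
          · rcases he1.eq_or_lt with rfl | he
            · exact .inl (one_mul _)
            · refine .inr ⟨(e - 1) * q t, .inl ⟨e - 1, by omega, by omega, rfl⟩, ?_⟩
              rw [add_comm, ← Nat.succ_mul, Nat.succ_eq_add_one, Nat.sub_add_cancel he1]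
          · exact .inr ⟨_, .inr ⟨r, hr, rfl⟩, by ring⟩
    obtain ⟨h1, h2⟩ := key (d t) le_rfl
    rw [digitValue_succ, digitPartialSums_succ, sum_range_succ]
    exact ⟨h1, h2⟩

/-! ### Existence, uniqueness and conclusion -/

theorem isLazyOstrowski_iff {α : ℝ} (hα : Irrational α) (hα0 : 0 < α) (hα1 : α < 1) {n t : ℕ}
    {d : ℕ → ℕ} : IsLazyOstrowski α n t d ↔ 0 < d t ∧ (∀ i, t < i → d i = 0) ∧
      LazyBelow (partialQuotient α) d (t + 1) ∧ n = digitValue (contDen α) d (t + 1) := by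
  have hden : convergentDen α = contDen α := funext (convergentDen_eq_contDen hα hα0 hα1)
  constructor
  · rintro ⟨h1, h2, h3, h4, h5, h6, h7⟩
    rw [hden] at h7
    exact ⟨h1, h2, ⟨h3, fun i h h' => h4 i h (by omega), fun i h h' => h5 i h (by omega),
      fun h => h6 (by omega)⟩, h7⟩
  · rintro ⟨h1, h2, h3, h4⟩
    refine ⟨h1, h2, h3.zero_lt, fun i h h' => h3.le i h (by omega),
      fun i h h' => h3.lazy i h (by omega), fun h => h3.lazy_one (by omega), ?_⟩
    rw [hden]
    exact h4

theorem ostrowskiPartialSums_eq {α : ℝ} (hα : Irrational α) (hα0 : 0 < α) (hα1 : α < 1) (t : ℕ)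
    (d : ℕ → ℕ) : ostrowskiPartialSums α t d = digitPartialSums (contDen α) d (t + 1) := by
  have hden : convergentDen α = contDen α := funext (convergentDen_eq_contDen hα hα0 hα1)
  have hI (j : ℕ) : Ioc j t = Ioo j (t + 1) := by ext i; simp
  simp only [ostrowskiPartialSums, digitPartialSums, hden, hI, Nat.lt_succ_iff]

/-- A nonzero digit at position `s + 1` gives at least `q (s + 1) + q s - 1`, beyond the maximum of
any shorter expansion. -/
theorem IsContinuantSeq.length_le {a q d d' : ℕ → ℕ} (hq : IsContinuantSeq a q) {t t' : ℕ}
    (h : LazyBelow a d (t + 1)) (h' : LazyBelow a d' (t' + 1)) (hpos : 0 < d' t')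
    (heq : digitValue q d (t + 1) = digitValue q d' (t' + 1)) : t' ≤ t := by
  by_contra! hlt
  obtain ⟨s, rfl⟩ : ∃ s, t' = s + 1 := ⟨t' - 1, by omega⟩
  have h1 := hq.digitValue_add_two_le h
  have h2 := hq.le_digitValue_add_one (h'.mono (Nat.le_succ _))
  have h3 := Nat.mul_le_mul_right (q (s + 1)) hpos
  have h4 := hq.strictMono_add.monotone (show t ≤ s by omega)
  rw [digitValue_succ _ d'] at heq
  simp only [Nat.succ_eq_add_one] at *
  omega

theorem existsUnique_isLazyOstrowski {α : ℝ} (hα : Irrational α) (hα0 : 0 < α) (hα1 : α < 1)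
    {n : ℕ} (hn : 1 ≤ n) : ∃! r : ℕ × (ℕ → ℕ), IsLazyOstrowski α n r.1 r.2 := by
  have hq := isContinuantSeq_contDen hα hα0 hα1
  obtain ⟨t, ht1, ht2⟩ := hq.exists_length n
  have hqt : contDen α t ≤ n + 1 := by
    rcases eq_or_ne t 0 with rfl | h0
    · rw [hq.zero]; omega
    · have := ht1 h0; omega
  obtain ⟨d, hd, hval⟩ := hq.exists_digits hqt ht2
  -- Otherwise the value is below the window that selected `t`.
  have htop : 0 < d t := by
    rw [digitValue_succ] at hval
    by_contra! h0
    rw [Nat.le_zero.1 h0, zero_mul, add_zero] at hval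
    cases t with
    | zero => simp [digitValue] at hval; omega
    | succ s =>
      have h1 := ht1 (by omega)
      have h2 := hq.digitValue_add_two_le (hd.mono (Nat.le_succ _))
      simp only [Nat.add_sub_cancel] at *
      omega
  -- Digits beyond `t` are unconstrained so far and must be set to zero for uniqueness as functions.
  have htr (i : ℕ) (hi : i < t + 1) : (fun i => if i < t + 1 then d i else 0) i = d i := if_pos hi
  refine ⟨(t, fun i => if i < t + 1 then d i else 0), (isLazyOstrowski_iff hα hα0 hα1).2
    ⟨by simpa using htop, fun i hi => if_neg (by omega), hd.congr htr,
      ((digitValue_congr htr).trans hval).symm⟩, ?_⟩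
  rintro ⟨t', d'⟩ h'
  obtain ⟨hpos', hzero', hd', hval'⟩ := (isLazyOstrowski_iff hα hα0 hα1).1 h'
  simp only at hpos' hzero' hd' hval'
  obtain rfl : t' = t := le_antisymm (hq.length_le hd hd' hpos' (hval.trans hval'))
    (hq.length_le hd' hd htop (hval'.symm.trans hval.symm))
  refine Prod.ext rfl (funext fun i => ?_)
  by_cases hi : i < t' + 1
  · simp only [hi, if_true]
    exact hq.digits_unique (hd'.mono (Nat.le_succ _)) (hd.mono (Nat.le_succ _))
      (hval'.symm.trans hval.symm) i (by omega)
  · simp only [hi, if_false]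
    exact hzero' i (by omega)

theorem theorem6 (α : ℝ) (hα : Irrational α) (hα0 : 0 < α) (hα1 : α < 1) (n : ℕ) (hn : 1 ≤ n) :
    (∃! r : ℕ × (ℕ → ℕ), IsLazyOstrowski α n r.1 r.2) ∧
    ∀ (t : ℕ) (d : ℕ → ℕ), IsLazyOstrowski α n t d →
      (periods (sturmianPrefix α n)).ncard = ∑ i ∈ Finset.range (t + 1), d i ∧
      periods (sturmianPrefix α n) = ostrowskiPartialSums α t d := by
  refine ⟨existsUnique_isLazyOstrowski hα hα0 hα1 hn, fun t d h => ?_⟩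
  obtain ⟨-, -, hd, rfl⟩ := (isLazyOstrowski_iff hα hα0 hα1).1 h
  rw [ostrowskiPartialSums_eq hα hα0 hα1]
  exact (periods_sturmianPrefix_digitValue hα hα0 hα1 hd).symm
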